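/- All graphs are finite, simple and undirected. Let $G=(N_G,E_G)$ be a graph with an edge-labeling $\lambda\colon E_G\to\mathbb{Z}_{>0}$. For $k\in\mathbb{Z}_{>0}$ write $\pi_k=\lambda^{-1}(k)$ and $\pi_{\le k}$, $\pi_{<k}$ for the sets of edges of label at most $k$, respectively less than $k$. The labeling $\lambda$ is an \emph{MAT-labeling} of $G$ (and $(G,\lambda)$ is an \emph{MAT-labeled graph}) if for every $k\in\mathbb{Z}_{>0}$: (ML1) no edge $e\in\pi_{\le k}$ forms a cycle with edges in $\pi_k$, i.e. there is no cycle that contains $e$ and all of whose edges other than $e$ lie in $\pi_k$; (ML2) every edge $e\in\pi_k$ forms exactly $k-1$ triangles with edges in $\pi_{<k}$, i.e. there are exactly $k-1$ vertices $w$ such that both edges joining $w$ to the endvertices of $e$ exist in $G$ and have label less than $k$. \textbf{Proposition.} Let $(G,\lambda)$ be an MAT-labeled graph and let $K$ be the complete graph with vertex set $N_G$. Then there exists an MAT-labeling $\widetilde\lambda$ of $K$ such that $(G,\lambda)$ is an MAT-labeled subgraph of $(K,\widetilde\lambda)$; that is, $\widetilde\lambda(e)=\lambda(e)$ for every edge $e\in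 E_G$. -/

import Mathlib

namespace MATGraph

variable {V : Type*}

/-- The set `π_k` of edges of label `k`, for an edge-labeling `lam` of `G` by positive integers. -/
def labelEq {G : SimpleGraph V} (lam : G.edgeSet → ℕ+) (k : ℕ+) : Set (Sym2 V) :=
  {e | ∃ h : e ∈ G.edgeSet, lam ⟨e, h⟩ = k}

/-- The set `π_{≤ k}` of edges of label at most `k`. -/
def labelLE {G : SimpleGraph V} (lam : G.edgeSet → ℕ+) (k : ℕ+) : Set (Sym2 V) :=
  {e | ∃ h : e ∈ G.edgeSet, lam ⟨e, h⟩ ≤ k}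

/-- The set `π_{< k}` of edges of label less than `k`. -/
def labelLT {G : SimpleGraph V} (lam : G.edgeSet → ℕ+) (k : ℕ+) : Set (Sym2 V) :=
  {e | ∃ h : e ∈ G.edgeSet, lam ⟨e, h⟩ < k}

/-- The edge `e` forms a cycle with edges in `S`: the graph whose edges are `e` and
the elements of `S` has a cycle that contains `e`. -/
def FormsCycleWith (e : Sym2 V) (S : Set (Sym2 V)) : Prop :=
  ∃ (v : V) (c : (SimpleGraph.fromEdgeSet (insert e S)).Walk v v), c.IsCycle ∧ e ∈ c.edges

/-- The vertices `w` that form a triangle with the edge `e` (given as an unordered pair) whose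
other two edges, joining `w` to the two endvertices of `e`, lie in `S`. They correspond
one-to-one to the triangles that `e` forms with edges in `S`. When `e` has label `k` and
`S = π_{< k}`, they are the conditioning vertices of `e`. -/
def triangleApexes (e : Sym2 V) (S : Set (Sym2 V)) : Set V :=
  {w | w ∉ e ∧ ∀ u ∈ e, s(u, w) ∈ S}

/-- MAT-labelings of a simple graph. -/
structure IsMATLabeling (G : SimpleGraph V) (lam : G.edgeSet → ℕ+) : Prop where
  /-- An edge of label at most `k` forms no cycle with edges of label `k`. -/
  no_cycle : ∀ k : ℕ+, ∀ e ∈ labelLE lam k, ¬ FormsCycleWith e (labelEq lam k)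
  /-- An edge of label `k` forms exactly `k - 1` triangles with edges of label less than `k`. -/
  triangles : ∀ k : ℕ+, ∀ e ∈ labelEq lam k,
    (triangleApexes e (labelLT lam k)).encard = ((k : ℕ) - 1 : ℕ)

/-- `(G', lam')` is an MAT-labeled subgraph of the MAT-labeled graph `(G, lam)`, for graphs
on the same vertex set: `G'` is a subgraph of `G`, `lam'` is the restriction of `lam` to the edges
of `G'`, and both labelings are MAT-labelings. -/
def IsMATLabeledSubgraph (G' : SimpleGraph V) (lam' : G'.edgeSet → ℕ+)
    (G : SimpleGraph V) (lam : G.edgeSet → ℕ+) : Prop :=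
  IsMATLabeling G lam ∧ IsMATLabeling G' lam' ∧
    ∃ hle : G' ≤ G, ∀ e : G'.edgeSet, lam' e = lam ⟨e, SimpleGraph.edgeSet_mono hle e.2⟩

end MATGraph

namespace MATGraph
open Relation

/-! ### Arrays, MAT-simplicial vertices and elimination. -/

section Arrays

/-! The completion is built along an elimination order. A vertex is MAT-simplicial when its edges
have distinct labels and its neighbours form a clique, each edge of which has a label below the
larger of the two labels joining its ends to the vertex. Deleting such a vertex `x` leaves an
MAT-labeling (`IsMATArray.del`); the rest is completed by induction, and `x` is then joined to all
other vertices with its old labels kept.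

That such vertices exist (`hasSimplicial`) is shown by induction on the largest label, in a local
form: every nonempty set whose outside neighbours lie in a node contains one. When the vertex found
below the top label has several top edges, locality allows a descent to a smaller set. Separation by
cliques, a form of chordality, drives this step (`not_connected_of_top`).

To rejoin `x`, the other vertices must be numbered `1, 2, …` so that every label is below the larger
number at its ends (`isMATArray_cone`). The old labels at `x` number its old neighbours in this way.
Such a numbering extends one vertex at a time if every proper node can grow (`HasGrowth`); the
induction carries this property along (`hasGrowth_cone`). -/

lemma reflTransGen_symm {α : Type*} {r : α → α → Prop} (hr : ∀ u v, r u v → r v u) {a b : α}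
    (h : ReflTransGen r a b) : ReflTransGen r b a := by
  induction h with
  | refl => exact .refl
  | tail _ huv ih => exact ih.head (hr _ _ huv)

variable {V : Type*}

/-- Adjacency in the graph of nonzero entries of `L`, away from `A`. -/
def avoidRel (L : V → V → ℕ) (A : Finset V) (u v : V) : Prop :=
  0 < L u v ∧ u ∉ A ∧ v ∉ A

/-- Edges of label `k` other than the edge `ab`. -/
def labelRel (L : V → V → ℕ) (k : ℕ) (a b : V) (u v : V) : Prop :=
  L u v = k ∧ s(u, v) ≠ s(a, b)

/-- The apexes of the triangles on `ab` whose other two edges have smaller label. -/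
def apexes [Fintype V] (L : V → V → ℕ) (a b : V) : Finset V :=
  Finset.univ.filter fun w => (0 < L a w ∧ L a w < L a b) ∧ (0 < L b w ∧ L b w < L a b)

/-- MAT-labelings, encoded as symmetric arrays in which `0` stands for a non-edge. -/
structure IsMATArray [Fintype V] (L : V → V → ℕ) : Prop where
  symm : ∀ a b, L a b = L b a
  irrefl : ∀ a, L a a = 0
  -- An edge lies on a cycle exactly when its ends remain connected without it.
  acyclic : ∀ k a b, 0 < L a b → L a b ≤ k → ¬ ReflTransGen (labelRel L k a b) a b
  card_apexes : ∀ a b, 0 < L a b → (apexes L a b).card + 1 = L a b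

/-- MAT-simplicial vertices. -/
structure IsMATSimplicial (L : V → V → ℕ) (x : V) : Prop where
  inj : ∀ a b, 0 < L x a → L x a = L x b → a = b
  clique : ∀ a b, a ≠ b → 0 < L x a → 0 < L x b → 0 < L a b ∧ L a b < max (L x a) (L x b)

/-- Cliques of size `d` with all labels less than `d`. -/
def IsNode (L : V → V → ℕ) (Q : Finset V) : Prop :=
  ∀ a ∈ Q, ∀ b ∈ Q, a ≠ b → 0 < L a b ∧ L a b < Q.card

/-- Keep only the edges of label at most `m`. -/
def trunc (L : V → V → ℕ) (m : ℕ) (a b : V) : ℕ := if L a b ≤ m then L a b else 0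

/-- Make the vertex `x` isolated. -/
def del [DecidableEq V] (L : V → V → ℕ) (x a b : V) : ℕ := if a = x ∨ b = x then 0 else L a b

/-- The neighbours of `x`. -/
def nbrs [Fintype V] (L : V → V → ℕ) (x : V) : Finset V := Finset.univ.filter fun w => 0 < L x w

section Basic

variable {L : V → V → ℕ} {m : ℕ} {a b x : V}

lemma trunc_pos : 0 < trunc L m a b ↔ 0 < L a b ∧ L a b ≤ m := by
  unfold trunc; split_ifs with h <;> simp [h]

lemma trunc_of_pos (h : 0 < trunc L m a b) : trunc L m a b = L a b := by
  unfold trunc at *; split_ifs at * <;> simp_all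

lemma trunc_of_le (h : L a b ≤ m) : trunc L m a b = L a b := by
  simp [trunc, h]

lemma trunc_le : trunc L m a b ≤ m := by
  unfold trunc; split_ifs <;> omega

variable [DecidableEq V]

lemma del_pos : 0 < del L x a b ↔ 0 < L a b ∧ a ≠ x ∧ b ≠ x := by
  unfold del; split_ifs with h <;> grind

lemma del_of_ne (ha : a ≠ x) (hb : b ≠ x) : del L x a b = L a b := by
  simp [del, ha, hb]

lemma del_le : del L x a b ≤ L a b := by
  unfold del; split_ifs <;> omega

end Basic

variable [Fintype V]

lemma mem_apexes {L : V → V → ℕ} {a b w : V} : w ∈ apexes L a b ↔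
    (0 < L a w ∧ L a w < L a b) ∧ (0 < L b w ∧ L b w < L a b) := by
  simp [apexes]

lemma mem_nbrs {L : V → V → ℕ} {x w : V} : w ∈ nbrs L x ↔ 0 < L x w := by
  simp [nbrs]

variable {L : V → V → ℕ}

lemma IsMATArray.ne (h : IsMATArray L) {a b : V} (hab : 0 < L a b) : a ≠ b := by
  rintro rfl; simp [h.irrefl] at hab

lemma IsMATArray.trunc (h : IsMATArray L) (m : ℕ) : IsMATArray (trunc L m) where
  symm a b := by simp [MATGraph.trunc, h.symm a b]
  irrefl a := by simp [MATGraph.trunc, h.irrefl a]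
  acyclic k a b hab hk hr := by
    rw [trunc_of_pos hab] at hk
    refine h.acyclic k a b (trunc_pos.1 hab).1 hk (ReflTransGen.mono ?_ _ _ hr)
    rintro u v ⟨huv, hne⟩
    -- Erased edges also have entry `0`, so only positive `k` identifies label classes.
    have hk0 : 0 < k := lt_of_lt_of_le (trunc_pos.1 hab).1 hk
    exact ⟨by rw [← huv, trunc_of_pos (by omega)], hne⟩
  card_apexes a b hab := by
    have hL := trunc_of_pos hab
    have : apexes (MATGraph.trunc L m) a b = apexes L a b := by
      ext w
      rw [mem_apexes, mem_apexes, hL]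
      have := (trunc_pos.1 hab).2
      constructor
      · rintro ⟨⟨h1, h2⟩, h3, h4⟩
        have e1 := trunc_of_pos h1
        have e2 := trunc_of_pos h3
        rw [e1] at h1 h2
        rw [e2] at h3 h4
        exact ⟨⟨h1, h2⟩, h3, h4⟩
      · rintro ⟨⟨h1, h2⟩, h3, h4⟩
        rw [trunc_of_le (by omega), trunc_of_le (by omega)]
        exact ⟨⟨h1, h2⟩, h3, h4⟩
    rw [this, hL]
    exact h.card_apexes a b (trunc_pos.1 hab).1

/-- A MAT-simplicial `x` is never a counted apex: an edge `ab` between neighbours has label below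
the larger of those on `xa` and `xb`. So no apex count changes. -/
lemma IsMATArray.del [DecidableEq V] (h : IsMATArray L) {x : V} (hx : IsMATSimplicial L x) :
    IsMATArray (del L x) where
  symm a b := by simp only [MATGraph.del, h.symm a b, or_comm]
  irrefl a := by simp [MATGraph.del, h.irrefl a]
  acyclic k a b hab hk hr := by
    obtain ⟨h0, ha, hb⟩ := del_pos.1 hab
    rw [del_of_ne ha hb] at hk
    refine h.acyclic k a b h0 hk (ReflTransGen.mono ?_ _ _ hr)
    rintro u v ⟨huv, hne⟩
    obtain ⟨-, hu, hv⟩ := del_pos.1 (show 0 < MATGraph.del L x u v by omega)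
    exact ⟨by rw [← huv, del_of_ne hu hv], hne⟩
  card_apexes a b hab := by
    obtain ⟨h0, ha, hb⟩ := del_pos.1 hab
    have : apexes (MATGraph.del L x) a b = apexes L a b := by
      ext w
      rw [mem_apexes, mem_apexes, del_of_ne ha hb]
      by_cases hw : w = x
      · subst hw
        have := hx.clique a b (h.ne h0)
        rw [h.symm a w, h.symm b w]
        simp only [MATGraph.del, or_true, if_true]
        constructor
        · rintro ⟨⟨h1, -⟩, -⟩; omega
        · rintro ⟨⟨h1, h2⟩, h3, h4⟩
          have := (this h1 h3).2
          have := max_lt h2 h4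
          omega
      · rw [del_of_ne ha hw, del_of_ne hb hw]
    rw [this, del_of_ne ha hb]
    exact h.card_apexes a b h0

lemma IsMATSimplicial.card_lt_le {x : V} (hx : IsMATSimplicial L x) (j : ℕ) :
    (Finset.univ.filter fun w => 0 < L x w ∧ L x w ≤ j).card ≤ j := by
  calc _ ≤ (Finset.Icc 1 j).card := by
        apply Finset.card_le_card_of_injOn (L x)
        · intro w hw; simp at hw ⊢; omega
        · intro a ha b hb hab
          simp at ha
          exact hx.inj a b ha.1 hab
    _ = j := by simp

lemma IsMATSimplicial.card_nbrs_le {x : V} (hx : IsMATSimplicial L x) {m : ℕ}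
    (hm : ∀ a b, L a b ≤ m) : (nbrs L x).card ≤ m := by
  convert hx.card_lt_le m using 2
  ext w; simp [nbrs, hm]

/-- In a MAT-labeling with labels at most `m`, every nonempty set of vertices whose outside
neighbours lie in a node contains a MAT-simplicial vertex. -/
def HasSimplicial (V : Type*) [Fintype V] (m : ℕ) : Prop :=
  ∀ L : V → V → ℕ, IsMATArray L → (∀ a b, L a b ≤ m) → ∀ Q U : Finset V, IsNode L Q →
    U.Nonempty → Disjoint Q U → (∀ a ∈ U, ∀ b, 0 < L a b → b ∈ U ∨ b ∈ Q) →
    ∃ x ∈ U, IsMATSimplicial L x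

lemma HasSimplicial.exists_mem {m : ℕ} (H : HasSimplicial V m) (h : IsMATArray L)
    (hm : ∀ a b, L a b ≤ m) {S : Finset V} (hS : S.Nonempty)
    (hcl : ∀ a ∈ S, ∀ b, 0 < L a b → b ∈ S) : ∃ x ∈ S, IsMATSimplicial L x :=
  H L h hm ∅ S (by simp [IsNode]) hS (by simp) fun a ha b hab => Or.inl (hcl a ha b hab)

/-- Deletion isolates `x` and keeps the vertex type, so the induction counts non-isolated vertices.
-/
theorem HasSimplicial.elimination [DecidableEq V] {m : ℕ} (H : HasSimplicial V m)
    {P : (V → V → ℕ) → Prop} (zero : ∀ L : V → V → ℕ, (∀ a b, L a b = 0) → P L)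
    (step : ∀ L x, IsMATArray L → (∀ a b, L a b ≤ m) → IsMATSimplicial L x →
      P (MATGraph.del L x) → P L)
    (h : IsMATArray L) (hm : ∀ a b, L a b ≤ m) : P L := by
  suffices ∀ (n : ℕ) (L : V → V → ℕ), IsMATArray L → (∀ a b, L a b ≤ m) →
      (Finset.univ.filter fun a => ∃ b, 0 < L a b).card = n → P L from this _ L h hm rfl
  intro n
  induction n using Nat.strong_induction_on with
  | _ n ih =>
    intro L h hm hn
    rcases Finset.eq_empty_or_nonempty (Finset.univ.filter fun a => ∃ b, 0 < L a b) with he | hne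
    · refine zero L fun a b => ?_
      have : a ∉ (Finset.univ.filter fun a => ∃ b, 0 < L a b) := by simp [he]
      simp at this
      exact this b
    · obtain ⟨x, hxS, hx⟩ := H.exists_mem h hm hne (by
        intro a _ b hab
        simp only [Finset.mem_filter, Finset.mem_univ, true_and]
        exact ⟨a, by rwa [h.symm]⟩)
      refine step L x h hm hx (ih _ ?_ _ (h.del hx) (fun a b => del_le.trans (hm a b)) rfl)
      rw [← hn]
      apply Finset.card_lt_card
      refine ⟨?_, fun hsub => ?_⟩
      · intro a
        simp only [Finset.mem_filter, Finset.mem_univ, true_and]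
        rintro ⟨b, hb⟩
        exact ⟨b, (del_pos.1 hb).1⟩
      · have := hsub hxS
        simp only [Finset.mem_filter, Finset.mem_univ, true_and] at this
        obtain ⟨b, hb⟩ := this
        exact (del_pos.1 hb).2.1 rfl

/-! ### Chordality: cliques and clique separators. -/

section Chordal

variable [DecidableEq V] {m : ℕ} (H : HasSimplicial V m) (h : IsMATArray L) (hm : ∀ a b, L a b ≤ m)
include H h hm

/-- Distinct labels leave a MAT-simplicial vertex at most `m` neighbours; apply this to the first
clique vertex eliminated. -/
lemma HasSimplicial.card_clique_le (C : Finset V) (hC : ∀ a ∈ C, ∀ b ∈ C, a ≠ b → 0 < L a b) :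
    C.card ≤ m + 1 := by
  revert C
  refine H.elimination (P := fun L => ∀ C : Finset V,
    (∀ a ∈ C, ∀ b ∈ C, a ≠ b → 0 < L a b) → C.card ≤ m + 1) ?_ ?_ h hm
  · intro L h0 C hC
    have : C.card ≤ 1 := Finset.card_le_one.2 fun a ha b hb => by
      by_contra hab
      have := hC a ha b hb hab
      rw [h0] at this
      omega
    omega
  · intro L x h hm hx ih C hC
    by_cases hxC : x ∈ C
    · have : (C.erase x) ⊆ nbrs L x := fun w hw => by
        rw [Finset.mem_erase] at hw
        exact mem_nbrs.2 (hC x hxC w hw.2 hw.1.symm)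
      have := Finset.card_le_card this
      have := hx.card_nbrs_le hm
      rw [Finset.card_erase_of_mem hxC] at *
      omega
    · exact ih C fun a ha b hb hab => del_pos.2 ⟨hC a ha b hb hab, by grind, by grind⟩

/-- The first of the four vertices to be eliminated has adjacent neighbours. It cannot be `a` or
`b`, since `x` and `y` are not adjacent. -/
lemma HasSimplicial.adj_of_square {x y a b : V} (hxy : x ≠ y) (hn : L x y = 0) (hab : a ≠ b)
    (hxa : 0 < L x a) (hxb : 0 < L x b) (hya : 0 < L y a) (hyb : 0 < L y b) : 0 < L a b := by
  refine (?_ : ∀ x y a b, x ≠ y → L x y = 0 → a ≠ b →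
    0 < L x a → 0 < L x b → 0 < L y a → 0 < L y b → 0 < L a b) x y a b hxy hn hab hxa hxb hya hyb
  clear! x y a b
  refine H.elimination (P := fun L => ∀ x y a b, x ≠ y → L x y = 0 → a ≠ b →
    0 < L x a → 0 < L x b → 0 < L y a → 0 < L y b → 0 < L a b) ?_ ?_ h hm
  · intro L h0 x y a b _ _ _ hxa
    rw [h0] at hxa; omega
  · intro L v h hm hv ih x y a b hxy hn hab hxa hxb hya hyb
    by_cases h1 : x = v
    · subst h1; exact (hv.clique a b hab hxa hxb).1
    by_cases h2 : y = v
    · subst h2; exact (hv.clique a b hab hya hyb).1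
    by_cases h3 : a = v
    · subst h3
      have := (hv.clique x y hxy (by rwa [h.symm]) (by rwa [h.symm])).1
      omega
    by_cases h4 : b = v
    · subst h4
      have := (hv.clique x y hxy (by rwa [h.symm]) (by rwa [h.symm])).1
      omega
    have := ih x y a b hxy (by rwa [del_of_ne h1 h2]) hab
    rw [del_of_ne h1 h3, del_of_ne h1 h4, del_of_ne h2 h3, del_of_ne h2 h4, del_of_ne h3 h4] at this
    exact this hxa hxb hya hyb

/-- `C` is a union of components of the graph minus `A`. In this form the separation is easily
updated when an eliminated vertex returns. -/
lemma HasSimplicial.exists_separation (A : Finset V) (y y' : V)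
    (hA : ∀ a ∈ A, ∀ b ∈ A, a ≠ b → 0 < L a b) (hcard : A.card = m) (hne : y ≠ y')
    (hy : ∀ a ∈ A, 0 < L y a) (hy' : ∀ a ∈ A, 0 < L y' a) :
    ∃ C : Set V, y ∈ C ∧ y' ∉ C ∧ (∀ a ∈ A, a ∉ C) ∧
      ∀ u ∈ C, ∀ v, 0 < L u v → v ∉ A → v ∈ C := by
  revert A y y'
  refine H.elimination (P := fun L => ∀ (A : Finset V) (y y' : V),
    (∀ a ∈ A, ∀ b ∈ A, a ≠ b → 0 < L a b) → A.card = m → y ≠ y' →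
    (∀ a ∈ A, 0 < L y a) → (∀ a ∈ A, 0 < L y' a) →
    ∃ C : Set V, y ∈ C ∧ y' ∉ C ∧ (∀ a ∈ A, a ∉ C) ∧
      ∀ u ∈ C, ∀ v, 0 < L u v → v ∉ A → v ∈ C) ?_ ?_ h hm
  · intro L h0 A y y' hA hc hne hy hy'
    refine ⟨{y}, rfl, fun h => hne h.symm, fun a ha => ?_, fun u _ v huv => ?_⟩
    · have := hy a ha
      rw [h0] at this; omega
    · rw [h0] at huv; omega
  · intro L x h hm hx ih A y y' hA hc hne hy hy'
    -- `A` already accounts for all of the at most `m` neighbours of `x`.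
    have key : (∀ a ∈ A, 0 < L x a) → ∀ v, 0 < L x v → v ∈ A := fun hxA v hv => by
      have hsub : A ⊆ nbrs L x := fun a ha => mem_nbrs.2 (hxA a ha)
      rw [Finset.eq_of_subset_of_card_le hsub (hc ▸ hx.card_nbrs_le hm)]
      exact mem_nbrs.2 hv
    have hyA : y ∉ A := fun hh => h.ne (hy y hh) rfl
    have hyA' : y' ∉ A := fun hh => h.ne (hy' y' hh) rfl
    by_cases h1 : x = y
    · subst h1
      refine ⟨{x}, rfl, fun h => hne h.symm, ?_, ?_⟩
      · rintro a ha rfl; exact hyA ha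
      · rintro u rfl v huv hv; exact absurd (key hy v huv) hv
    by_cases h2 : x = y'
    · subst h2
      refine ⟨{v | v ≠ x ∧ v ∉ A}, ⟨hne, hyA⟩, by simp, by simp_all, ?_⟩
      rintro u ⟨hu, huA⟩ v huv hv
      refine ⟨?_, hv⟩
      rintro rfl
      exact huA (key hy' u (by rwa [h.symm]))
    by_cases h3 : x ∈ A
    -- Here `y` and `y'` are neighbours of `x`, hence adjacent, and together with `A` they form a
    -- clique of size `m + 2`.
    · exfalso
      have hyy := (hx.clique y y' hne (by rw [h.symm]; exact hy x h3)
        (by rw [h.symm]; exact hy' x h3)).1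
      have := H.card_clique_le h hm (insert y (insert y' A)) (by
        intro a ha b hb hab
        simp only [Finset.mem_insert] at ha hb
        have hs := h.symm
        rcases ha with rfl | rfl | ha <;> rcases hb with rfl | rfl | hb <;> grind)
      rw [Finset.card_insert_of_notMem (by simp [hne, hyA]),
        Finset.card_insert_of_notMem hyA'] at this
      omega
    · have hax : ∀ a ∈ A, a ≠ x := fun a ha hh => h3 (hh ▸ ha)
      obtain ⟨C, hyC, hyC', hAC, hC⟩ := ih A y y'
        (fun a ha b hb hab => del_pos.2 ⟨hA a ha b hb hab, hax a ha, hax b hb⟩) hc hne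
        (fun a ha => del_pos.2 ⟨hy a ha, Ne.symm h1, hax a ha⟩)
        (fun a ha => del_pos.2 ⟨hy' a ha, Ne.symm h2, hax a ha⟩)
      -- The vertex `x` belongs in `C` exactly when it has a neighbour there; its other neighbours
      -- are then adjacent to that one.
      by_cases hc : ∃ c ∈ C, c ≠ x ∧ 0 < L x c
      · obtain ⟨c, hcC, hcx, hxc⟩ := hc
        refine ⟨insert x C, Or.inr hyC, ?_, ?_, ?_⟩
        · rintro (h | h)
          · exact h2 h.symm
          · exact hyC' h
        · rintro a ha (h | h)
          · exact hax a ha h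
          · exact hAC a ha h
        · intro u hu v huv hv
          by_cases hvx : v = x
          · exact Or.inl hvx
          refine Or.inr ?_
          by_cases hux : u = x
          · subst hux
            by_cases hvc : c = v
            · exact hvc ▸ hcC
            · exact hC c hcC v (del_pos.2 ⟨(hx.clique c v hvc hxc huv).1, hcx, hvx⟩) hv
          · exact hC u (hu.resolve_left hux) v (del_pos.2 ⟨huv, hux, hvx⟩) hv
      · push Not at hc
        refine ⟨C \ {x}, ⟨hyC, fun h => h1 h.symm⟩, fun h => hyC' h.1, fun a ha h => hAC a ha h.1,
          ?_⟩
        rintro u ⟨hu, hux⟩ v huv hv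
        have hvx : v ≠ x := by
          rintro rfl
          have := hc u hu hux
          rw [h.symm] at this
          omega
        exact ⟨hC u hu v (del_pos.2 ⟨huv, hux, hvx⟩) hv, hvx⟩

lemma HasSimplicial.not_connected (A : Finset V) (y y' : V)
    (hA : ∀ a ∈ A, ∀ b ∈ A, a ≠ b → 0 < L a b) (hcard : A.card = m) (hne : y ≠ y')
    (hy : ∀ a ∈ A, 0 < L y a) (hy' : ∀ a ∈ A, 0 < L y' a) :
    ¬ ReflTransGen (avoidRel L A) y y' := by
  obtain ⟨C, hyC, hyC', -, hC⟩ := H.exists_separation h hm A y y' hA hcard hne hy hy'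
  intro hr
  refine hyC' ?_
  clear hyC' hy' hne
  induction hr with
  | refl => exact hyC
  | tail _ huv ih => exact hC _ ih _ huv.1 huv.2.2

end Chordal

end Arrays

/-! ### Existence of MAT-simplicial vertices: induction on the largest label. -/

section Step

variable {V : Type*} {L : V → V → ℕ} {m : ℕ}

lemma isNode_of_trunc {Q : Finset V} (hQ : ∀ a ∈ Q, ∀ b ∈ Q, a ≠ b → 0 < trunc L m a b)
    (hcard : Q.card = m + 1) : IsNode (trunc L m) Q := fun a ha b hb hab =>
  ⟨hQ a ha b hb hab, by have := trunc_le (L := L) (m := m) (a := a) (b := b); omega⟩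

lemma IsNode.of_trunc {Q : Finset V} (hQ : IsNode (trunc L m) Q) : IsNode L Q :=
  fun a ha b hb hab => by
    have := hQ a ha b hb hab
    rwa [trunc_of_pos this.1] at this

variable [Fintype V]

/-- An edge of label `m + 1` has exactly `m` apexes, and `x` has at most `m` neighbours in the
truncation. -/
lemma apexes_eq_nbrs_trunc {x y : V} (h : IsMATArray L) (hx : IsMATSimplicial (trunc L m) x)
    (hxy : L x y = m + 1) : apexes L x y = nbrs (trunc L m) x := by
  apply Finset.eq_of_subset_of_card_le
  · intro w hw
    obtain ⟨⟨h1, h2⟩, -⟩ := mem_apexes.1 hw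
    exact mem_nbrs.2 (trunc_pos.2 ⟨h1, by omega⟩)
  · have := h.card_apexes x y (by omega)
    have := hx.card_nbrs_le (fun _ _ => trunc_le (L := L) (m := m))
    omega

lemma card_nbrs_trunc {x y : V} (h : IsMATArray L) (hx : IsMATSimplicial (trunc L m) x)
    (hxy : L x y = m + 1) : (nbrs (trunc L m) x).card = m := by
  rw [← apexes_eq_nbrs_trunc h hx hxy]
  have := h.card_apexes x y (by omega)
  omega

lemma trunc_pos_of_mem_nbrs {x y a : V} (h : IsMATArray L) (hx : IsMATSimplicial (trunc L m) x)
    (hxy : L x y = m + 1) (ha : a ∈ nbrs (trunc L m) x) : 0 < trunc L m y a := by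
  rw [← apexes_eq_nbrs_trunc h hx hxy] at ha
  obtain ⟨-, h1, h2⟩ := mem_apexes.1 ha
  exact trunc_pos.2 ⟨h1, by omega⟩

/-- Every lower neighbour of `x` is an apex of its top edge, hence joined to the other end by a
label at most `m`. -/
lemma IsMATSimplicial.of_trunc {x : V} (h : IsMATArray L) (hm : ∀ a b, L a b ≤ m + 1)
    (hx : IsMATSimplicial (trunc L m) x)
    (huniq : ∀ y y', L x y = m + 1 → L x y' = m + 1 → y = y') : IsMATSimplicial L x := by
  have cases : ∀ a, L x a ≤ m ∨ L x a = m + 1 := fun a => by have := hm x a; omega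
  have mixed : ∀ a b, 0 < L x a → L x a ≤ m → L x b = m + 1 → 0 < L a b ∧ L a b ≤ m := by
    intro a b h0 ha hb
    have := trunc_pos_of_mem_nbrs h hx hb (mem_nbrs.2 (trunc_pos.2 ⟨h0, ha⟩))
    rw [h.symm]
    exact trunc_pos.1 this
  constructor
  · intro a b h0 hab
    rcases cases a with ha | ha
    · refine hx.inj a b ?_ ?_
      · rwa [trunc_of_le ha]
      · rw [trunc_of_le ha, trunc_of_le (by omega), hab]
    · exact huniq a b ha (by omega)
  · intro a b hab h0a h0b
    rcases cases a with ha | ha <;> rcases cases b with hb | hb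
    · have := hx.clique a b hab (trunc_pos.2 ⟨h0a, ha⟩) (trunc_pos.2 ⟨h0b, hb⟩)
      rw [trunc_of_le ha, trunc_of_le hb] at this
      rwa [trunc_of_pos this.1] at this
    · have := mixed a b h0a ha hb
      exact ⟨this.1, lt_max_of_lt_right (by omega)⟩
    · have := mixed b a h0b hb ha
      rw [h.symm a b]
      exact ⟨this.1, lt_max_of_lt_left (by omega)⟩
    · exact absurd (huniq a b ha hb) hab

variable [DecidableEq V]

lemma isNode_insert_nbrs {x y : V} (h : IsMATArray L) (hx : IsMATSimplicial (trunc L m) x)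
    (hxy : L x y = m + 1) : IsNode (trunc L m) (insert x (nbrs (trunc L m) x)) := by
  have hs := (h.trunc m).symm
  have hxn : x ∉ nbrs (trunc L m) x := fun hh => (h.trunc m).ne (mem_nbrs.1 hh) rfl
  refine isNode_of_trunc ?_ (by rw [Finset.card_insert_of_notMem hxn, card_nbrs_trunc h hx hxy])
  intro a ha b hb hab
  simp only [Finset.mem_insert, mem_nbrs] at ha hb
  rcases ha with rfl | ha <;> rcases hb with rfl | hb
  · exact absurd rfl hab
  · exact hb
  · rwa [hs]
  · exact (hx.clique a b hab ha hb).1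

/-- Distinct neighbours `y`, `y'` of `x` along edges of the top label lie in different components
after removing `x` and its neighbours along the other edges. -/
lemma not_connected_of_top (H : HasSimplicial V m) (h : IsMATArray L) (hm : ∀ a b, L a b ≤ m + 1)
    {x y y' : V} (hx : IsMATSimplicial (trunc L m) x) (hy : L x y = m + 1) (hy' : L x y' = m + 1)
    (hne : y ≠ y') :
    ¬ ReflTransGen (avoidRel L (insert x (nbrs (trunc L m) x))) y y' := by
  intro hr
  set A := nbrs (trunc L m) x with hA
  have hAc : A.card = m := card_nbrs_trunc h hx hy
  have hAcl : ∀ a ∈ A, ∀ b ∈ A, a ≠ b → 0 < trunc L m a b := fun a ha b hb hab =>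
    (hx.clique a b hab (mem_nbrs.1 ha) (mem_nbrs.1 hb)).1
  have hsep : ∀ u v, (∀ a ∈ A, 0 < trunc L m u a) → (∀ a ∈ A, 0 < trunc L m v a) →
      ReflTransGen (avoidRel (trunc L m) A) u v → u = v := fun u v hu hv huv => by
    by_contra hne
    exact H.not_connected (h.trunc m) (fun _ _ => trunc_le) A u v hAcl hAc hne hu hv huv
  have hyA : ∀ a ∈ A, 0 < trunc L m y a := fun a ha => trunc_pos_of_mem_nbrs h hx hy ha
  have hyA' : ∀ a ∈ A, 0 < trunc L m y' a := fun a ha => trunc_pos_of_mem_nbrs h hx hy' ha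
  have hxy : x ≠ y := h.ne (by omega)
  -- The walk has a shadow `f`: complete to `A`, in the component of `v` in the truncation minus
  -- `A`, and reached from `y` by top edges alone. By `hsep` each component has at most one
  -- candidate for `f`.
  have key : ∀ v, ReflTransGen (avoidRel L (insert x A)) y v → ∃ f, (∀ a ∈ A, 0 < trunc L m f a) ∧
      ReflTransGen (avoidRel (trunc L m) A) f v ∧
      ReflTransGen (fun u w => L u w = m + 1 ∧ u ≠ x ∧ w ≠ x) y f := by
    intro v hv
    induction hv with
    | refl => exact ⟨y, hyA, .refl, .refl⟩
    | @tail u v _ huv ih =>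
      obtain ⟨f, hfA, hfu, hyf⟩ := ih
      obtain ⟨h0, hu, hv⟩ := huv
      simp only [Finset.mem_insert, not_or] at hu hv
      by_cases hle : L u v ≤ m
      · exact ⟨f, hfA, hfu.tail ⟨trunc_pos.2 ⟨h0, hle⟩, hu.2, hv.2⟩, hyf⟩
      · have htop : L u v = m + 1 := by have := hm u v; omega
        have hap : ∀ w ∈ apexes L u v, 0 < trunc L m u w ∧ 0 < trunc L m v w := fun w hw => by
          obtain ⟨⟨h1, h2⟩, h3, h4⟩ := mem_apexes.1 hw
          exact ⟨trunc_pos.2 ⟨h1, by omega⟩, trunc_pos.2 ⟨h3, by omega⟩⟩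
        -- If the apexes of a top edge `uv` are exactly `A`, then `f = u` and the shadow moves to
        -- `v`. Otherwise an apex outside `A` gives a detour from `u` to `v` below the top label.
        by_cases hsub : apexes L u v ⊆ A
        · have heq : apexes L u v = A := Finset.eq_of_subset_of_card_le hsub (by
            have := h.card_apexes u v h0
            omega)
          rw [heq] at hap
          have := hsep f u hfA (fun a ha => (hap a ha).1) hfu
          subst this
          exact ⟨v, fun a ha => (hap a ha).2, .refl, hyf.tail ⟨htop, hu.1, hv.1⟩⟩
        · obtain ⟨w, hw, hwA⟩ := Finset.not_subset.1 hsub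
          obtain ⟨h1, h2⟩ := hap w hw
          refine ⟨f, hfA, (hfu.tail ⟨h1, hu.2, hwA⟩).tail ⟨?_, hwA, hv.2⟩, hyf⟩
          rwa [(h.trunc m).symm]
  obtain ⟨f, hfA, hfy, hyf⟩ := key y' hr
  have := hsep f y' hfA hyA' hfy
  subst this
  -- The shadow has arrived at `y'`, so the top edges from `y` to `y'`, followed by `y'x`, close a
  -- cycle with `xy`.
  refine h.acyclic (m + 1) y x (by rw [h.symm]; omega) (hm _ _) ?_
  refine ReflTransGen.tail (b := f) (ReflTransGen.mono ?_ _ _ hyf) ⟨by rw [h.symm, hy'], ?_⟩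
  · rintro u w ⟨h1, h2, h3⟩
    refine ⟨h1, ?_⟩
    simp [h2, h3]
  · simp [hne.symm, hxy]

/-- A node with more than `m + 1` vertices has exactly one edge of label `m + 1`. -/
lemma IsNode.exists_top (H : HasSimplicial V m) (h : IsMATArray L) (hm : ∀ a b, L a b ≤ m + 1)
    {Q : Finset V} (hQ : IsNode L Q) (hcard : m + 1 < Q.card) :
    ∃ p ∈ Q, ∃ q ∈ Q, L p q = m + 1 ∧
      IsNode (trunc L m) (Q.erase p) ∧ IsNode (trunc L m) (Q.erase q) ∧ Q.card = m + 2 := by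
  have hclique := H.card_clique_le (h.trunc m) (fun _ _ => trunc_le)
  have hex : ∃ p ∈ Q, ∃ q ∈ Q, p ≠ q ∧ ¬ 0 < trunc L m p q := by
    by_contra! hcon
    have := hclique Q hcon
    omega
  have htop : ∀ p ∈ Q, ∀ q ∈ Q, p ≠ q → ¬ 0 < trunc L m p q → L p q = m + 1 := by
    intro p hp q hq hpq h0
    have h1 := (hQ p hp q hq hpq).1
    have h2 := hm p q
    by_contra h3
    exact h0 (trunc_pos.2 ⟨h1, by omega⟩)
  -- (ML1) forbids two top edges in a triangle.
  have htri : ∀ a ∈ Q, ∀ b ∈ Q, ∀ c ∈ Q, a ≠ b → a ≠ c → b ≠ c → L a b = m + 1 →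
      0 < trunc L m a c := by
    intro a ha b hb c hc hab hac hbc hL
    by_contra hcon
    have h2 := htop a ha c hc hac hcon
    refine h.acyclic (m + 1) b c (hQ b hb c hc hbc).1 (hm _ _) ?_
    refine ReflTransGen.tail (b := a) (ReflTransGen.single ⟨by rw [h.symm, hL], ?_⟩) ⟨h2, ?_⟩
    · simp [hab, hac]
    · simp [hab, hac]
  obtain ⟨p, hp, q, hq, hpq, h0⟩ := hex
  have hL := htop p hp q hq hpq h0
  have hs := (h.trunc m).symm
  have hpz : ∀ z ∈ Q, z ≠ p → z ≠ q → 0 < trunc L m p z := fun z hz h1 h2 =>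
    htri p hp q hq z hz hpq h1.symm h2.symm hL
  have hqz : ∀ z ∈ Q, z ≠ p → z ≠ q → 0 < trunc L m q z := fun z hz h1 h2 =>
    htri q hq p hp z hz hpq.symm h2.symm h1.symm (by rw [h.symm, hL])
  have hzz : ∀ z ∈ Q, ∀ z' ∈ Q, z ≠ z' → z ≠ p → z ≠ q → z' ≠ p → z' ≠ q →
      0 < trunc L m z z' := fun z hz z' hz' hne h1 h2 h3 h4 =>
    H.adj_of_square (h.trunc m) (fun _ _ => trunc_le) hpq (by omega) hne (hpz z hz h1 h2)
      (hpz z' hz' h3 h4) (hqz z hz h1 h2) (hqz z' hz' h3 h4)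
  have hcp : ∀ a ∈ Q.erase p, ∀ b ∈ Q.erase p, a ≠ b → 0 < trunc L m a b := by
    intro a ha b hb hab
    rw [Finset.mem_erase] at ha hb
    by_cases h1 : a = q
    · subst h1; exact hqz b hb.2 hb.1 hab.symm
    by_cases h2 : b = q
    · subst h2; rw [hs]; exact hqz a ha.2 ha.1 hab
    exact hzz a ha.2 b hb.2 hab ha.1 h1 hb.1 h2
  have hcq : ∀ a ∈ Q.erase q, ∀ b ∈ Q.erase q, a ≠ b → 0 < trunc L m a b := by
    intro a ha b hb hab
    rw [Finset.mem_erase] at ha hb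
    by_cases h1 : a = p
    · subst h1; exact hpz b hb.2 hab.symm hb.1
    by_cases h2 : b = p
    · subst h2; rw [hs]; exact hpz a ha.2 hab ha.1
    exact hzz a ha.2 b hb.2 hab h1 ha.1 h2 hb.1
  have hc := hclique _ hcp
  have e1 := Finset.card_erase_of_mem hp
  have e2 := Finset.card_erase_of_mem hq
  exact ⟨p, hp, q, hq, hL, isNode_of_trunc hcp (by omega), isNode_of_trunc hcq (by omega), by omega⟩

/-- Truncation spoils the node `Q` only by removing a single edge `pq`, and then `Q.erase p` and
`Q.erase q` are still nodes. A component of the truncation minus `Q` cannot touch both `p` and `q`,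
because the `m`-clique formed by the rest of `Q` separates them; so one of the two smaller nodes
suffices. -/
lemma exists_simplicial_trunc (H : HasSimplicial V m) (h : IsMATArray L)
    (hm : ∀ a b, L a b ≤ m + 1) {Q U : Finset V} (hQ : IsNode L Q) (hU : U.Nonempty)
    (hQU : Disjoint Q U) (hcl : ∀ a ∈ U, ∀ b, 0 < L a b → b ∈ U ∨ b ∈ Q) :
    ∃ x ∈ U, IsMATSimplicial (trunc L m) x := by
  classical
  by_cases hcard : Q.card ≤ m + 1
  · refine H _ (h.trunc m) (fun _ _ => trunc_le) Q U ?_ hU hQU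
      fun a ha b hab => hcl a ha b (trunc_pos.1 hab).1
    intro a ha b hb hab
    have := hQ a ha b hb hab
    rw [trunc_of_le (by omega)]
    exact this
  obtain ⟨p, hp, q, hq, hpq, hNp, hNq, hc⟩ := hQ.exists_top H h hm (not_le.1 hcard)
  have hne : p ≠ q := h.ne (by omega)
  have hs := (h.trunc m).symm
  obtain ⟨u, hu⟩ := hU
  set U₁ : Finset V := Finset.univ.filter (ReflTransGen (avoidRel (trunc L m) Q) u) with hU₁
  have hmem : ∀ v, v ∈ U₁ ↔ ReflTransGen (avoidRel (trunc L m) Q) u v := fun v => by simp [hU₁]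
  have hsub : U₁ ⊆ U := by
    intro v hv
    rw [hmem] at hv
    induction hv with
    | refl => exact hu
    | tail _ hvw ih => exact (hcl _ ih _ (trunc_pos.1 hvw.1).1).resolve_right hvw.2.2
  have hdisj : ∀ v ∈ U₁, v ∉ Q := fun v hv hvQ => Finset.disjoint_left.1 hQU hvQ (hsub hv)
  have hcl₁ : ∀ a ∈ U₁, ∀ b, 0 < trunc L m a b → b ∈ U₁ ∨ b ∈ Q := by
    intro a ha b hab
    by_cases hb : b ∈ Q
    · exact Or.inr hb
    · exact Or.inl ((hmem b).2 (((hmem a).1 ha).tail ⟨hab, hdisj a ha, hb⟩))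
  have huU : u ∈ U₁ := (hmem u).2 .refl
  have fin : ∀ r, IsNode (trunc L m) (Q.erase r) → (∀ a ∈ U₁, ¬ 0 < trunc L m a r) →
      ∃ x ∈ U, IsMATSimplicial (trunc L m) x := by
    intro r hN hr
    obtain ⟨x, hx, hxs⟩ := H _ (h.trunc m) (fun _ _ => trunc_le) (Q.erase r) U₁ hN ⟨u, huU⟩
      (Finset.disjoint_left.2 fun v hv hv' => hdisj v hv' (Finset.mem_of_mem_erase hv)) (by
        intro a ha b hab
        refine (hcl₁ a ha b hab).imp_right fun hb => Finset.mem_erase.2 ⟨?_, hb⟩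
        rintro rfl
        exact hr a ha hab)
    exact ⟨x, hsub hx, hxs⟩
  by_cases h1 : ∀ a ∈ U₁, ¬ 0 < trunc L m a p
  · exact fin p hNp h1
  by_cases h2 : ∀ a ∈ U₁, ¬ 0 < trunc L m a q
  · exact fin q hNq h2
  exfalso
  push Not at h1 h2
  obtain ⟨a, ha, hap⟩ := h1
  obtain ⟨b, hb, hbq⟩ := h2
  have hsymm : ∀ v w, avoidRel (trunc L m) Q v w → avoidRel (trunc L m) Q w v := fun v w hvw =>
    ⟨by rw [hs]; exact hvw.1, hvw.2.2, hvw.2.1⟩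
  have hab : ReflTransGen (avoidRel (trunc L m) Q) a b :=
    (reflTransGen_symm hsymm ((hmem a).1 ha)).trans ((hmem b).1 hb)
  have hmono : ReflTransGen (avoidRel (trunc L m) ((Q.erase p).erase q)) a b :=
    ReflTransGen.mono (fun v w hvw => ⟨hvw.1, by simp [hvw.2.1], by simp [hvw.2.2]⟩) _ _ hab
  have hpath : ReflTransGen (avoidRel (trunc L m) ((Q.erase p).erase q)) p q :=
    (ReflTransGen.head ⟨by rwa [hs], by simp, by simp [hdisj a ha]⟩ hmono).tail
      ⟨hbq, by simp [hdisj b hb], by simp⟩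
  refine H.not_connected (h.trunc m) (fun _ _ => trunc_le) _ p q ?_ ?_ hne ?_ ?_ hpath
  · intro a ha b hb hab
    exact (hNp a (Finset.mem_of_mem_erase ha) b (Finset.mem_of_mem_erase hb) hab).1
  · rw [Finset.card_erase_of_mem (Finset.mem_erase.2 ⟨hne.symm, hq⟩), Finset.card_erase_of_mem hp]
    omega
  · intro a ha
    simp only [Finset.mem_erase] at ha
    exact (hNq p (by simp [hp, hne]) a (by simp [ha]) (Ne.symm ha.2.1)).1
  · intro a ha
    simp only [Finset.mem_erase] at ha
    exact (hNp q (by simp [hq, hne.symm]) a (by simp [ha]) (Ne.symm ha.1)).1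

omit [DecidableEq V] in
-- Let `x` be MAT-simplicial in the truncation. If it has two top edges, their other ends lie in
-- different components after removal of the node `Q'`. The clique `Q` cannot meet both components,
-- so one of them lies inside `U`; it omits `x` and has all its outside neighbours in `Q'`, so
-- induction on the size of `U` applies.
theorem HasSimplicial.succ (H : HasSimplicial V m) : HasSimplicial V (m + 1) := by
  classical
  intro L h hm Q U
  induction hn : U.card using Nat.strong_induction_on generalizing Q U with
  | _ n ih =>
    intro hQ hU hQU hcl
    obtain ⟨x, hxU, hx⟩ := exists_simplicial_trunc H h hm hQ hU hQU hcl
    by_cases huniq : ∀ y y', L x y = m + 1 → L x y' = m + 1 → y = y'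
    · exact ⟨x, hxU, hx.of_trunc h hm huniq⟩
    push Not at huniq
    obtain ⟨y₁, y₂, hy₁, hy₂, hne⟩ := huniq
    set Q' := insert x (nbrs (trunc L m) x) with hQ'
    have hsymm : ∀ v w, avoidRel L Q' v w → avoidRel L Q' w v := fun v w hvw =>
      ⟨by rw [h.symm]; exact hvw.1, hvw.2.2, hvw.2.1⟩
    have hsep := not_connected_of_top H h hm hx hy₁ hy₂ hne
    have hnot : ∀ y, L x y = m + 1 → y ∉ Q' := by
      intro y hy hyQ
      rcases Finset.mem_insert.1 hyQ with rfl | hyA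
      · rw [h.irrefl] at hy; omega
      · have := (trunc_pos.1 (mem_nbrs.1 hyA)).2; omega
    have hcomp : ∀ y, L x y = m + 1 → ∀ v, ReflTransGen (avoidRel L Q') y v → v ∉ Q' := by
      intro y hy v hv
      cases hv with
      | refl => exact hnot y hy
      | tail _ huv => exact huv.2.2
    have hxQ : x ∉ Q := fun hh => Finset.disjoint_left.1 hQU hh hxU
    have hchoose : ∃ y, L x y = m + 1 ∧ ∀ v ∈ Q, ¬ ReflTransGen (avoidRel L Q') y v := by
      by_contra! hcon
      obtain ⟨v₁, hv₁, hr₁⟩ := hcon y₁ hy₁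
      obtain ⟨v₂, hv₂, hr₂⟩ := hcon y₂ hy₂
      refine hsep (ReflTransGen.trans ?_ (reflTransGen_symm hsymm hr₂))
      by_cases he : v₁ = v₂
      · exact he ▸ hr₁
      · exact hr₁.tail ⟨(hQ v₁ hv₁ v₂ hv₂ he).1, hcomp y₁ hy₁ v₁ hr₁, hcomp y₂ hy₂ v₂ hr₂⟩
    obtain ⟨y, hy, hyQ⟩ := hchoose
    set K : Finset V := Finset.univ.filter (ReflTransGen (avoidRel L Q') y) with hK
    have hmem : ∀ v, v ∈ K ↔ ReflTransGen (avoidRel L Q') y v := fun v => by simp [hK]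
    have hKQ' : ∀ v ∈ K, v ∉ Q' := fun v hv => hcomp y hy v ((hmem v).1 hv)
    have hsub : K ⊆ U := by
      intro v hv
      rw [hmem] at hv
      induction hv with
      | refl =>
        exact (hcl x hxU y (by omega)).resolve_right fun hh => hyQ y hh .refl
      | @tail v w hv hvw ih =>
        exact (hcl v ih w hvw.1).resolve_right fun hh => hyQ w hh (hv.tail hvw)
    have hlt : K.card < n := by
      rw [← hn]
      refine Finset.card_lt_card ⟨hsub, fun hh => ?_⟩
      exact hKQ' x (hh hxU) (Finset.mem_insert_self _ _)
    obtain ⟨z, hz, hzs⟩ := ih _ hlt Q' K rfl (isNode_insert_nbrs h hx hy).of_trunc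
      ⟨y, (hmem y).2 .refl⟩ (Finset.disjoint_left.2 fun v hv hv' => hKQ' v hv' hv) (by
        intro a ha b hab
        by_cases hb : b ∈ Q'
        · exact Or.inr hb
        · exact Or.inl ((hmem b).2 (((hmem a).1 ha).tail ⟨hab, hKQ' a ha, hb⟩)))
    exact ⟨z, hsub hz, hzs⟩

omit [DecidableEq V] in
theorem hasSimplicial (m : ℕ) : HasSimplicial V m := by
  classical
  induction m with
  | zero =>
    intro L _ hm Q U _ hU _ _
    obtain ⟨x, hx⟩ := hU
    refine ⟨x, hx, fun a b h0 => ?_, fun a b _ h0 => ?_⟩ <;>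
    · have := hm x a
      omega
  | succ m ih => exact ih.succ

end Step

/-! ### Completion: numberings, growth and cones. -/

section Extension

variable {V : Type*} {K : V → V → ℕ} {x : V}

/-- If `x` has at most one `r`-neighbour, then `r`-walks between other vertices can avoid `x`. -/
lemma reflTransGen_avoid {r : V → V → Prop} (huniq : ∀ u v, r u x → r x v → u = v)
    {p q : V} (hp : p ≠ x) (h : ReflTransGen r p q) :
    (q ≠ x → ReflTransGen (fun u v => r u v ∧ u ≠ x ∧ v ≠ x) p q) ∧
    (q = x → ∃ u, u ≠ x ∧ r u x ∧ ReflTransGen (fun u v => r u v ∧ u ≠ x ∧ v ≠ x) p u) := by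
  induction h with
  | refl => exact ⟨fun _ => .refl, fun h => absurd h hp⟩
  | @tail u v _ huv ih =>
    by_cases hu : u = x
    · subst hu
      obtain ⟨w, hw, hr, hpw⟩ := ih.2 rfl
      have := huniq w v hr huv
      subst this
      exact ⟨fun _ => hpw, fun h => absurd h hw⟩
    · refine ⟨fun hv => (ih.1 hu).tail ⟨huv, hu, hv⟩, ?_⟩
      rintro rfl
      exact ⟨u, hu, huv, ih.1 hu⟩

variable [Fintype V]

/-- The labels at `x` have no gaps: distinctness gives the upper bound, the apexes of `xa` the lower
one. -/
lemma IsMATSimplicial.card_label_lt (h : IsMATArray K) (hx : IsMATSimplicial K x) {a : V}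
    (ha : 0 < K x a) : (Finset.univ.filter fun w => 0 < K x w ∧ K x w < K x a).card + 1 = K x a := by
  apply le_antisymm
  · have := hx.card_lt_le (K x a - 1)
    have heq : (Finset.univ.filter fun w => 0 < K x w ∧ K x w < K x a) =
        Finset.univ.filter fun w => 0 < K x w ∧ K x w ≤ K x a - 1 := by
      ext w; simp; omega
    rw [heq]
    omega
  · conv_lhs => rw [← h.card_apexes x a ha]
    gcongr
    intro w hw
    simpa using (mem_apexes.1 hw).1

variable [DecidableEq V]

/-- Adding a MAT-simplicial vertex to an MAT-labeled graph gives an MAT-labeled graph. -/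
theorem isMATArray_of_del (hdel : IsMATArray (del K x)) (hs : ∀ a b, K a b = K b a)
    (h0 : K x x = 0) (hx : IsMATSimplicial K x)
    (hcard : ∀ a, 0 < K x a → (Finset.univ.filter fun w => 0 < K x w ∧ K x w < K x a).card + 1 =
      K x a) : IsMATArray K := by
  have hirr : ∀ a, K a a = 0 := fun a => by
    by_cases ha : a = x
    · rw [ha, h0]
    · rw [← del_of_ne (L := K) ha ha]; exact hdel.irrefl a
  have huniq : ∀ k a b, 0 < k → ∀ u v, labelRel K k a b u x → labelRel K k a b x v → u = v :=
    fun k a b hk u v hu hv => hx.inj u v (by rw [hs, hu.1]; exact hk) (by rw [hs, hu.1, hv.1])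
  -- A cycle through `xb` has a second edge `xu` at `x`, of label `k`. Distinctness puts the label
  -- of `xb` below `k`, hence that of `bu` as well, and `bu` closes a forbidden cycle in the graph
  -- without `x`.
  have hback : ∀ k a b, 0 < k → 0 < K x b → K x b ≤ k → a = x →
      ¬ ReflTransGen (labelRel K k a b) b a := by
    rintro k a b hk hb hbk rfl hr
    have hne : b ≠ a := by rintro rfl; omega
    obtain ⟨u, hu, hua, hbu⟩ := (reflTransGen_avoid (huniq k a b hk) hne hr).2 rfl
    have hub : u ≠ b := by rintro rfl; exact hua.2 Sym2.eq_swap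
    have hau : K a u = k := by rw [hs, hua.1]
    have hbk' : K a b < k := lt_of_le_of_ne hbk fun he =>
      hub (hx.inj u b (by omega) (by omega))
    obtain ⟨h1, h2⟩ := hx.clique b u hub.symm hb (by omega)
    rw [hau, max_eq_right hbk] at h2
    refine hdel.acyclic k b u (del_pos.2 ⟨h1, hne, hu⟩) (by rw [del_of_ne hne hu]; exact h2.le)
      (ReflTransGen.mono ?_ _ _ hbu)
    rintro v w ⟨⟨hvw, -⟩, hv, hw⟩
    refine ⟨by rw [del_of_ne hv hw, hvw], fun he => ?_⟩
    rcases Sym2.eq_iff.1 he with ⟨rfl, rfl⟩ | ⟨rfl, rfl⟩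
    · omega
    · rw [hs] at hvw; omega
  refine ⟨hs, hirr, ?_, ?_⟩
  · intro k a b hab hk hr
    have hk0 : 0 < k := by omega
    have hswap : ∀ u v, labelRel K k a b u v → labelRel K k a b v u := fun u v huv =>
      ⟨by rw [hs, huv.1], by rw [Sym2.eq_swap]; exact huv.2⟩
    by_cases ha : a = x
    · exact hback k a b hk0 (ha ▸ hab) (ha ▸ hk) ha (reflTransGen_symm hswap hr)
    by_cases hb : b = x
    · refine hback k b a hk0 (by rwa [← hb, hs]) (by rwa [← hb, hs]) hb (ReflTransGen.mono ?_ _ _ hr)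
      exact fun u v huv => ⟨huv.1, by rw [Sym2.eq_swap (a := b)]; exact huv.2⟩
    refine hdel.acyclic k a b (del_pos.2 ⟨hab, ha, hb⟩) (by rwa [del_of_ne ha hb])
      (ReflTransGen.mono ?_ _ _ ((reflTransGen_avoid (huniq k a b hk0) ha hr).1 hb))
    rintro u v ⟨huv, hu, hv⟩
    exact ⟨by rw [del_of_ne hu hv, huv.1], huv.2⟩
  -- The condition on `bw` is automatic: its label is below the larger of those on `xb` and `xw`,
  -- which is that of `xb`.
  · have hxcase : ∀ b, 0 < K x b → (apexes K x b).card + 1 = K x b := by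
      intro b hb
      convert hcard b hb using 3
      ext w
      simp only [mem_apexes, Finset.mem_filter, Finset.mem_univ, true_and]
      refine ⟨fun h => h.1, fun h => ⟨h, ?_⟩⟩
      have hne : b ≠ w := by rintro rfl; omega
      have := hx.clique b w hne hb h.1
      rwa [max_eq_left h.2.le] at this
    intro a b hab
    by_cases ha : a = x
    · subst ha; exact hxcase b hab
    by_cases hb : b = x
    · subst hb
      rw [hs] at hab
      rw [hs a, ← hxcase a hab]
      congr 2
      ext w
      rw [mem_apexes, mem_apexes, hs a b, and_comm]
    · have := hdel.card_apexes a b (del_pos.2 ⟨hab, ha, hb⟩)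
      rw [del_of_ne ha hb] at this
      rw [← this]
      congr 2
      ext w
      rw [mem_apexes, mem_apexes, del_of_ne ha hb]
      by_cases hw : w = x
      · subst hw
        simp only [del, or_true, if_true, lt_irrefl, false_and, iff_false]
        rintro ⟨⟨h1, h2⟩, h3, h4⟩
        have := (hx.clique a b (fun h => by rw [h, hirr] at hab; omega)
          (by rwa [hs]) (by rwa [hs])).2
        rw [hs w, hs w] at this
        exact absurd (max_lt h2 h4) (by omega)
      · rw [del_of_ne ha hw, del_of_ne hb hw]

/-- Every node of `S` other than `S` can be enlarged by a vertex whose labels to the node are at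
most the size of the node. -/
def HasGrowth (K : V → V → ℕ) (S : Finset V) : Prop :=
  ∀ T ⊆ S, IsNode K T → T ≠ S → ∃ w ∈ S, w ∉ T ∧ ∀ t ∈ T, K t w ≤ T.card

/-- `f` numbers `T` by `1, …, |T|`, with each label in `T` smaller than the larger number. -/
structure IsNumbering (K : V → V → ℕ) (T : Finset V) (f : V → ℕ) : Prop where
  inj : ∀ a ∈ T, ∀ b ∈ T, f a = f b → a = b
  pos : ∀ a ∈ T, 0 < f a
  le : ∀ a ∈ T, f a ≤ T.card
  lt_max : ∀ a ∈ T, ∀ b ∈ T, a ≠ b → K a b < max (f a) (f b)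

omit [Fintype V] in
-- A numbered `T` is a node, so growth provides `w` with labels to `T` at most `T.card`; the number
-- `T.card + 1` for `w` exceeds them all.
lemma IsNumbering.exists_extension {S T : Finset V} {f : V → ℕ} (hs : ∀ a b, K a b = K b a)
    (hcomp : ∀ a ∈ S, ∀ b ∈ S, a ≠ b → 0 < K a b) (hK : HasGrowth K S) (hTS : T ⊆ S)
    (hf : IsNumbering K T f) : ∃ g, IsNumbering K S g ∧ ∀ a ∈ T, g a = f a := by
  induction hn : (S \ T).card generalizing T f with
  | zero =>
    have : S = T := Finset.Subset.antisymm (Finset.sdiff_eq_empty_iff_subset.1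
      (Finset.card_eq_zero.1 hn)) hTS
    subst this
    exact ⟨f, hf, fun _ _ => rfl⟩
  | succ n ih =>
    have hne : T ≠ S := by rintro rfl; simp at hn
    have hnode : IsNode K T := fun a ha b hb hab =>
      ⟨hcomp a (hTS ha) b (hTS hb) hab,
        (hf.lt_max a ha b hb hab).trans_le (max_le (hf.le a ha) (hf.le b hb))⟩
    obtain ⟨w, hwS, hwT, hw⟩ := hK T hTS hnode hne
    have hup : ∀ a ∈ T, Function.update f w (T.card + 1) a = f a := fun a ha =>
      Function.update_of_ne (by rintro rfl; exact hwT ha) _ _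
    have hupw : Function.update f w (T.card + 1) w = T.card + 1 := Function.update_self _ _ _
    have hle := hf.le
    have hc : (insert w T).card = T.card + 1 := Finset.card_insert_of_notMem hwT
    obtain ⟨g, hg, hgf⟩ := ih (T := insert w T) (f := Function.update f w (T.card + 1))
      (Finset.insert_subset hwS hTS) (by
        constructor
        · intro a ha b hb hab
          rcases Finset.mem_insert.1 ha with rfl | ha' <;>
            rcases Finset.mem_insert.1 hb with rfl | hb'
          · rfl
          · rw [hupw, hup b hb'] at hab
            have := hle b hb'
            omega
          · rw [hupw, hup a ha'] at hab
            have := hle a ha'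
            omega
          · rw [hup a ha', hup b hb'] at hab
            exact hf.inj a ha' b hb' hab
        · intro a ha
          rcases Finset.mem_insert.1 ha with rfl | ha
          · rw [hupw]; omega
          · rw [hup a ha]; exact hf.pos a ha
        · intro a ha
          rcases Finset.mem_insert.1 ha with rfl | ha
          · rw [hupw]; omega
          · rw [hup a ha]; have := hle a ha; omega
        · intro a ha b hb hab
          rcases Finset.mem_insert.1 ha with rfl | ha' <;>
            rcases Finset.mem_insert.1 hb with rfl | hb'
          · exact absurd rfl hab
          · rw [hupw, hs]
            exact lt_max_of_lt_left (Nat.lt_succ_of_le (hw b hb'))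
          · rw [hupw]
            exact lt_max_of_lt_right (Nat.lt_succ_of_le (hw a ha'))
          · rw [hup a ha', hup b hb']
            exact hf.lt_max a ha' b hb' hab) (by
        have h1 := Finset.card_sdiff_of_subset (Finset.insert_subset hwS hTS)
        have h2 := Finset.card_sdiff_of_subset hTS
        omega)
    exact ⟨g, hg, fun a ha => by rw [hgf a (Finset.mem_insert_of_mem ha), hup a ha]⟩

omit [Fintype V] [DecidableEq V] in
lemma IsNumbering.exists_eq {S : Finset V} {f : V → ℕ} (hf : IsNumbering K S f) {j : ℕ} (h0 : 0 < j)
    (hj : j ≤ S.card) : ∃ a ∈ S, f a = j := by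
  have := Finset.surj_on_of_inj_on_of_card_le (s := S) (t := Finset.Icc 1 S.card) (fun a _ => f a)
    (fun a ha => Finset.mem_Icc.2 ⟨hf.pos a ha, hf.le a ha⟩)
    (fun a b ha hb hab => hf.inj a ha b hb hab) (by simp) j (Finset.mem_Icc.2 ⟨h0, hj⟩)
  obtain ⟨a, ha, h⟩ := this
  exact ⟨a, ha, h.symm⟩

omit [Fintype V] [DecidableEq V] in
lemma IsNumbering.card_lt {S : Finset V} {f : V → ℕ} (hf : IsNumbering K S f) {j : ℕ} (h0 : 0 < j)
    (hj : j ≤ S.card) : (S.filter fun w => f w < j).card + 1 = j := by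
  have : (S.filter fun w => f w < j).card = (Finset.Ico 1 j).card := by
    refine Finset.card_bij (fun a _ => f a) ?_ ?_ ?_
    · intro a ha
      rw [Finset.mem_filter] at ha
      exact Finset.mem_Ico.2 ⟨hf.pos a ha.1, ha.2⟩
    · intro a ha b hb hab
      exact hf.inj a (Finset.mem_filter.1 ha).1 b (Finset.mem_filter.1 hb).1 hab
    · intro i hi
      rw [Finset.mem_Ico] at hi
      obtain ⟨a, ha, rfl⟩ := hf.exists_eq (j := i) (by omega) (by omega)
      exact ⟨a, Finset.mem_filter.2 ⟨ha, hi.2⟩, rfl⟩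
  rw [this, Nat.card_Ico]
  omega

/-- Join a new vertex `x` to the vertices of `S` by edges labelled by `f`. -/
def cone (K : V → V → ℕ) (S : Finset V) (x : V) (f : V → ℕ) (a b : V) : ℕ :=
  if a = x then (if b ∈ S then f b else 0) else
  if b = x then (if a ∈ S then f a else 0) else K a b

section Cone

variable {S : Finset V} {f : V → ℕ}

omit [Fintype V] in
lemma cone_of_ne {a b : V} (ha : a ≠ x) (hb : b ≠ x) : cone K S x f a b = K a b := by
  simp [cone, ha, hb]

omit [Fintype V] in
lemma cone_apex {a : V} (ha : a ∈ S) : cone K S x f x a = f a := by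
  simp [cone, ha]

omit [Fintype V] in
lemma cone_symm (hs : ∀ a b, K a b = K b a) (a b : V) : cone K S x f a b = cone K S x f b a := by
  unfold cone
  split_ifs <;> simp_all

omit [Fintype V] in
lemma mem_of_cone_pos {a : V} (h : 0 < cone K S x f x a) : a ∈ S := by
  by_contra ha
  simp [cone, ha] at h

lemma isMATArray_cone (hK : IsMATArray K) (hsupp : ∀ a b, 0 < K a b → a ∈ S)
    (hcomp : ∀ a ∈ S, ∀ b ∈ S, a ≠ b → 0 < K a b) (hx : x ∉ S) (hf : IsNumbering K S f) :
    IsMATArray (cone K S x f) := by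
  have hdel : del (cone K S x f) x = K := by
    ext a b
    by_cases ha : a = x
    · subst ha
      have : ¬ 0 < K a b := fun h => hx (hsupp a b h)
      simp [del]; omega
    by_cases hb : b = x
    · subst hb
      have : ¬ 0 < K a b := fun h => hx (hsupp b a (by rwa [hK.symm]))
      simp [del]; omega
    rw [del_of_ne ha hb, cone_of_ne ha hb]
  have hne : ∀ a ∈ S, a ≠ x := fun a ha h => hx (h ▸ ha)
  refine isMATArray_of_del (by rwa [hdel]) (cone_symm hK.symm) (by simp [cone, hx]) ?_ ?_
  · constructor
    · intro a b ha hab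
      have hb := mem_of_cone_pos (hab ▸ ha)
      have ha := mem_of_cone_pos ha
      rw [cone_apex ha, cone_apex hb] at hab
      exact hf.inj a ha b hb hab
    · intro a b hab ha hb
      have ha := mem_of_cone_pos ha
      have hb := mem_of_cone_pos hb
      rw [cone_apex ha, cone_apex hb, cone_of_ne (hne a ha) (hne b hb)]
      exact ⟨hcomp a ha b hb hab, hf.lt_max a ha b hb hab⟩
  · intro a ha
    have ha := mem_of_cone_pos ha
    rw [cone_apex ha]
    rw [← hf.card_lt (hf.pos a ha) (hf.le a ha)]
    congr 2
    ext w
    simp only [Finset.mem_filter, Finset.mem_univ, true_and]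
    constructor
    · rintro ⟨h1, h2⟩
      have hw := mem_of_cone_pos h1
      rw [cone_apex hw] at h2
      exact ⟨hw, by rwa [hf.card_lt (hf.pos a ha) (hf.le a ha)] at h2⟩
    · rintro ⟨hw, h2⟩
      rw [cone_apex hw]
      exact ⟨hf.pos w hw, by rwa [hf.card_lt (hf.pos a ha) (hf.le a ha)]⟩

omit [Fintype V] in
-- If a node `T` contains `x`, its other vertices have numbers below `T.card`, so the vertex
-- numbered `T.card` is outside `T` and can be added. If `T` omits `x`, growth in `S` applies, and
-- `S` itself grows by `x`.
lemma hasGrowth_cone (hs : ∀ a b, K a b = K b a) (hK : HasGrowth K S) (hx : x ∉ S)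
    (hf : IsNumbering K S f) : HasGrowth (cone K S x f) (insert x S) := by
  have hne : ∀ a ∈ S, a ≠ x := fun a ha h => hx (h ▸ ha)
  intro T hT hnode hTS
  by_cases hxT : x ∈ T
  · have hTe : T.erase x ⊆ S := fun u hu =>
      (Finset.mem_insert.1 (hT (Finset.mem_of_mem_erase hu))).resolve_left
        (Finset.ne_of_mem_erase hu)
    have hlt : ∀ u ∈ T, u ≠ x → f u < T.card := fun u hu hux => by
      have := (hnode x hxT u hu hux.symm).2
      rwa [cone_apex (hTe (Finset.mem_erase.2 ⟨hux, hu⟩))] at this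
    have hcT : 0 < T.card := Finset.card_pos.2 ⟨x, hxT⟩
    have hce := Finset.card_erase_of_mem hxT
    have hle : T.card ≤ S.card := by
      have := Finset.card_lt_card (Finset.ssubset_iff_subset_ne.2 ⟨hT, hTS⟩)
      rw [Finset.card_insert_of_notMem hx] at this
      omega
    obtain ⟨w, hw, hfw⟩ := hf.exists_eq hcT hle
    refine ⟨w, Finset.mem_insert_of_mem hw, fun hwT => ?_, fun t ht => ?_⟩
    · have := hlt w hwT (hne w hw)
      omega
    · by_cases htx : t = x
      · rw [htx, cone_apex hw, hfw]
      · have htS := hTe (Finset.mem_erase.2 ⟨htx, ht⟩)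
        have htlt := hlt t ht htx
        rw [cone_of_ne htx (hne w hw)]
        have := hf.lt_max t htS w hw (by rintro rfl; omega)
        rw [hfw, max_eq_right htlt.le] at this
        exact this.le
  · have hTS' : T ⊆ S := fun t ht => (Finset.mem_insert.1 (hT ht)).resolve_left
      fun h => hxT (h ▸ ht)
    by_cases heq : T = S
    · subst heq
      refine ⟨x, Finset.mem_insert_self _ _, hx, fun t ht => ?_⟩
      rw [cone_symm hs, cone_apex ht]
      exact hf.le t ht
    · obtain ⟨w, hw, hwT, hle⟩ := hK T hTS' (fun a ha b hb hab => by
        have := hnode a ha b hb hab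
        rwa [cone_of_ne (hne a (hTS' ha)) (hne b (hTS' hb))] at this) heq
      refine ⟨w, Finset.mem_insert_of_mem hw, hwT, fun t ht => ?_⟩
      rw [cone_of_ne (hne t (hTS' ht)) (hne w hw)]
      exact hle t ht

end Cone

omit [DecidableEq V] in
/-- The neighbours of a MAT-simplicial vertex are numbered by their labels. -/
lemma IsMATSimplicial.isNumbering {L : V → V → ℕ} (h : IsMATArray L) (hx : IsMATSimplicial L x)
    (hKL : ∀ a b, a ≠ x → b ≠ x → 0 < L a b → K a b = L a b) :
    IsNumbering K (nbrs L x) (L x) where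
  inj a ha b _ hab := hx.inj a b (mem_nbrs.1 ha) hab
  pos a ha := mem_nbrs.1 ha
  le a ha := by
    rw [mem_nbrs] at ha
    -- The label of `xa` is one more than the number of neighbours with smaller label, and `a` is
    -- not among these.
    rw [← hx.card_label_lt h ha]
    apply Finset.card_lt_card
    refine ⟨fun w hw => ?_, fun hsub => ?_⟩
    · exact mem_nbrs.2 (Finset.mem_filter.1 hw).2.1
    · have := hsub (mem_nbrs.2 ha)
      simp at this
  lt_max a ha b hb hab := by
    rw [mem_nbrs] at ha hb
    obtain ⟨h1, h2⟩ := hx.clique a b hab ha hb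
    rwa [hKL a b (h.ne ha).symm (h.ne hb).symm h1]

/-- Induction on `S` inside a fixed vertex type. The growth clause is there only for the induction:
it allows the labels at the deleted vertex to be extended to a numbering of `S.erase x`. -/
theorem exists_complete_extension (S : Finset V) {L : V → V → ℕ} (h : IsMATArray L)
    (hsupp : ∀ a b, 0 < L a b → a ∈ S) :
    ∃ K : V → V → ℕ, IsMATArray K ∧ (∀ a b, 0 < K a b → a ∈ S) ∧
      (∀ a ∈ S, ∀ b ∈ S, a ≠ b → 0 < K a b) ∧ (∀ a b, 0 < L a b → K a b = L a b) ∧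
      HasGrowth K S := by
  induction hn : S.card generalizing S L with
  | zero =>
    rw [Finset.card_eq_zero] at hn
    subst hn
    refine ⟨L, h, hsupp, by simp, fun _ _ _ => rfl, fun T hT _ hne => ?_⟩
    exact absurd (Finset.subset_empty.1 hT) hne
  | succ n ih =>
    obtain ⟨m, hm⟩ : ∃ m, ∀ a b, L a b ≤ m := by
      refine ⟨Finset.univ.sup fun p : V × V => L p.1 p.2, fun a b => ?_⟩
      exact Finset.le_sup (f := fun p : V × V => L p.1 p.2) (Finset.mem_univ (a, b))
    obtain ⟨x, hxS, hx⟩ := (hasSimplicial (V := V) m).exists_mem h hm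
      (Finset.card_pos.1 (by omega : 0 < S.card)) fun a _ b hab => hsupp b a (by rwa [h.symm])
    obtain ⟨K, hK, hKs, hKc, hKL, hKg⟩ := ih (S.erase x) (h.del hx) (fun a b hab => by
      obtain ⟨h0, ha, -⟩ := del_pos.1 hab
      exact Finset.mem_erase.2 ⟨ha, hsupp a b h0⟩) (by rw [Finset.card_erase_of_mem hxS]; omega)
    have hKL' : ∀ a b, a ≠ x → b ≠ x → 0 < L a b → K a b = L a b := fun a b ha hb hab => by
      rw [hKL a b (del_pos.2 ⟨hab, ha, hb⟩), del_of_ne ha hb]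
    have hnS : nbrs L x ⊆ S.erase x := fun w hw => by
      rw [mem_nbrs] at hw
      exact Finset.mem_erase.2 ⟨(h.ne hw).symm, hsupp w x (by rwa [h.symm])⟩
    obtain ⟨f, hf, hfL⟩ := (hx.isNumbering h hKL').exists_extension hK.symm hKc hKg hnS
    have hxe : x ∉ S.erase x := Finset.notMem_erase x S
    have hLx : ∀ b, 0 < L x b → cone K (S.erase x) x f x b = L x b := fun b hb => by
      rw [cone_apex (hnS (mem_nbrs.2 hb)), hfL b (mem_nbrs.2 hb)]
    refine ⟨cone K (S.erase x) x f, isMATArray_cone hK hKs hKc hxe hf, ?_, ?_, ?_, ?_⟩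
    · intro a b hab
      by_cases ha : a = x
      · rwa [ha]
      by_cases hb : b = x
      · subst hb
        rw [cone_symm hK.symm] at hab
        exact Finset.mem_of_mem_erase (mem_of_cone_pos hab)
      · rw [cone_of_ne ha hb] at hab
        exact Finset.mem_of_mem_erase (hKs a b hab)
    · intro a ha b hb hab
      by_cases hax : a = x
      · subst hax
        have hb' := Finset.mem_erase.2 ⟨hab.symm, hb⟩
        rw [cone_apex hb']
        exact hf.pos b hb'
      by_cases hbx : b = x
      · subst hbx
        have ha' := Finset.mem_erase.2 ⟨hab, ha⟩
        rw [cone_symm hK.symm, cone_apex ha']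
        exact hf.pos a ha'
      · rw [cone_of_ne hax hbx]
        exact hKc a (Finset.mem_erase.2 ⟨hax, ha⟩) b (Finset.mem_erase.2 ⟨hbx, hb⟩) hab
    · intro a b hab
      by_cases hax : a = x
      · subst hax; exact hLx b hab
      by_cases hbx : b = x
      · subst hbx
        rw [cone_symm hK.symm, h.symm]
        exact hLx a (by rwa [h.symm])
      · rw [cone_of_ne hax hbx]; exact hKL' a b hax hbx hab
    · have := hasGrowth_cone hK.symm hKg hxe hf
      rwa [Finset.insert_erase hxS] at this

end Extension

/-! ### Translation between edge-labelings and arrays. -/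

section Translation

variable {V : Type*} {G : SimpleGraph V}

open Classical in
/-- The array of an edge-labeling. -/
noncomputable def toArray (lam : G.edgeSet → ℕ+) (a b : V) : ℕ :=
  if h : s(a, b) ∈ G.edgeSet then (lam ⟨s(a, b), h⟩ : ℕ) else 0

variable {lam : G.edgeSet → ℕ+} {a b : V} {k : ℕ+}

lemma toArray_of_mem (h : s(a, b) ∈ G.edgeSet) : toArray lam a b = lam ⟨s(a, b), h⟩ := by
  simp only [toArray, dif_pos h]

lemma toArray_pos : 0 < toArray lam a b ↔ s(a, b) ∈ G.edgeSet := by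
  unfold toArray
  split_ifs with h
  · simp [h]
  · simp [h]

open Classical in
lemma toArray_symm (a b : V) : toArray lam a b = toArray lam b a :=
  congrArg (fun e => if h : e ∈ G.edgeSet then (lam ⟨e, h⟩ : ℕ) else 0) Sym2.eq_swap

lemma toArray_self (a : V) : toArray lam a a = 0 := by
  by_contra h
  have := toArray_pos.1 (Nat.pos_of_ne_zero h)
  simp at this

lemma mem_labelEq : s(a, b) ∈ labelEq lam k ↔ toArray lam a b = k := by
  constructor
  · rintro ⟨h, hk⟩
    rw [toArray_of_mem h, hk]
  · intro hk
    have h := toArray_pos.1 (hk ▸ k.pos)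
    rw [toArray_of_mem h] at hk
    exact ⟨h, PNat.coe_injective hk⟩

lemma mem_labelLE : s(a, b) ∈ labelLE lam k ↔ 0 < toArray lam a b ∧ toArray lam a b ≤ k := by
  constructor
  · rintro ⟨h, hk⟩
    exact ⟨toArray_pos.2 h, by rw [toArray_of_mem h]; exact_mod_cast hk⟩
  · rintro ⟨h, hk⟩
    have h := toArray_pos.1 h
    rw [toArray_of_mem h] at hk
    exact ⟨h, by exact_mod_cast hk⟩

lemma mem_labelLT : s(a, b) ∈ labelLT lam k ↔ 0 < toArray lam a b ∧ toArray lam a b < k := by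
  constructor
  · rintro ⟨h, hk⟩
    exact ⟨toArray_pos.2 h, by rw [toArray_of_mem h]; exact_mod_cast hk⟩
  · rintro ⟨h, hk⟩
    have h := toArray_pos.1 h
    rw [toArray_of_mem h] at hk
    exact ⟨h, by exact_mod_cast hk⟩

/-- An edge is on a cycle if and only if it is not a bridge. -/
lemma formsCycleWith_iff {S : Set (Sym2 V)} (hab : a ≠ b) : FormsCycleWith s(a, b) S ↔
    ReflTransGen (fun u v => u ≠ v ∧ s(u, v) ∈ S ∧ s(u, v) ≠ s(a, b)) a b := by
  have hadj : (SimpleGraph.fromEdgeSet (insert s(a, b) S)).Adj a b := by simp [hab]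
  have hrel : (SimpleGraph.fromEdgeSet (insert s(a, b) S) \ SimpleGraph.fromEdgeSet {s(a, b)}).Adj =
      fun u v => u ≠ v ∧ s(u, v) ∈ S ∧ s(u, v) ≠ s(a, b) := by
    ext u v
    simp only [SimpleGraph.sdiff_adj, SimpleGraph.fromEdgeSet_adj, Set.mem_insert_iff,
      Set.mem_singleton_iff]
    tauto
  rw [← hrel, ← SimpleGraph.reachable_iff_reflTransGen]
  unfold FormsCycleWith
  rw [← SimpleGraph.adj_and_reachable_delete_edges_iff_exists_cycle]
  exact and_iff_right hadj

lemma formsCycleWith_labelEq_iff (hab : a ≠ b) : FormsCycleWith s(a, b) (labelEq lam k) ↔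
    ReflTransGen (labelRel (toArray lam) k a b) a b := by
  rw [formsCycleWith_iff hab]
  refine iff_of_eq (congrArg (fun r => ReflTransGen r a b) ?_)
  ext u v
  rw [mem_labelEq]
  refine ⟨fun h => h.2, fun h => ⟨?_, h⟩⟩
  rintro rfl
  have := h.1
  rw [toArray_self] at this
  exact k.pos.ne this

lemma triangleApexes_eq [Fintype V] (hk : toArray lam a b = k) :
    triangleApexes s(a, b) (labelLT lam k) = apexes (toArray lam) a b := by
  ext w
  simp only [triangleApexes, Set.mem_ofPred_eq, Finset.mem_coe, mem_apexes, hk, Sym2.mem_iff,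
    forall_eq_or_imp, forall_eq, mem_labelLT]
  refine ⟨fun h => h.2, fun h => ⟨?_, h⟩⟩
  rintro (rfl | rfl)
  · simp [toArray_self] at h
  · simp [toArray_self] at h

theorem isMATLabeling_iff [Fintype V] : IsMATLabeling G lam ↔ IsMATArray (toArray lam) := by
  have hcard : ∀ (n : ℕ) (j : ℕ), 0 < j → ((n : ℕ∞) = ((j - 1 : ℕ) : ℕ∞) ↔ n + 1 = j) := by
    intro n j hj
    rw [Nat.cast_inj]
    omega
  have hne : ∀ {a b : V}, 0 < toArray lam a b → a ≠ b := by
    rintro a b h rfl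
    rw [toArray_self] at h
    omega
  constructor
  · intro h
    refine ⟨toArray_symm, toArray_self, fun k a b h0 hk hr => ?_, fun a b h0 => ?_⟩
    · lift k to ℕ+ using h0.trans_le hk
      exact h.no_cycle k s(a, b) (mem_labelLE.2 ⟨h0, hk⟩) ((formsCycleWith_labelEq_iff (hne h0)).2 hr)
    · obtain ⟨k, hk⟩ : ∃ k : ℕ+, toArray lam a b = k := ⟨⟨_, h0⟩, rfl⟩
      have := h.triangles k s(a, b) (mem_labelEq.2 hk)
      rw [triangleApexes_eq hk, Set.encard_coe_eq_coe_finsetCard, hcard _ _ k.pos] at this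
      rw [this, hk]
  · intro h
    constructor
    · intro k e
      induction e with
      | h a b =>
        intro he hc
        obtain ⟨h0, hk⟩ := mem_labelLE.1 he
        exact h.acyclic k a b h0 hk ((formsCycleWith_labelEq_iff (hne h0)).1 hc)
    · intro k e
      induction e with
      | h a b =>
        intro he
        have hk := mem_labelEq.1 he
        rw [triangleApexes_eq hk, Set.encard_coe_eq_coe_finsetCard, hcard _ _ k.pos,
          h.card_apexes a b (by rw [hk]; exact k.pos), hk]

lemma exists_toArray_eq {K : V → V → ℕ} (hs : ∀ a b, K a b = K b a) (h0 : ∀ a, K a a = 0)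
    (hpos : ∀ a b, a ≠ b → 0 < K a b) :
    ∃ lam : (⊤ : SimpleGraph V).edgeSet → ℕ+, toArray lam = K := by
  have hlift : ∀ e : (⊤ : SimpleGraph V).edgeSet, 0 < Sym2.lift ⟨K, hs⟩ e.1 := by
    rintro ⟨e, he⟩
    induction e with
    | h a b => exact hpos a b (by simpa using he)
  refine ⟨fun e => Nat.toPNat _ (hlift e), ?_⟩
  ext a b
  by_cases hab : a = b
  · subst hab
    rw [toArray_self, h0]
  · rw [toArray_of_mem (by simpa using hab)]
    rfl

end Translation

end MATGraph

theorem mainTheorem12 {V : Type*} [Finite V] (G : SimpleGraph V) (lam : G.edgeSet → ℕ+)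
    (hlam : MATGraph.IsMATLabeling G lam) :
    ∃ lam' : (⊤ : SimpleGraph V).edgeSet → ℕ+,
      MATGraph.IsMATLabeling ⊤ lam' ∧ MATGraph.IsMATLabeledSubgraph G lam ⊤ lam' := by
  classical
  have := Fintype.ofFinite V
  obtain ⟨K, hK, -, hKc, hKL, -⟩ := MATGraph.exists_complete_extension Finset.univ
    (MATGraph.isMATLabeling_iff.1 hlam) (by simp)
  obtain ⟨lam', rfl⟩ := MATGraph.exists_toArray_eq hK.symm hK.irrefl
    fun a b hab => hKc a (Finset.mem_univ a) b (Finset.mem_univ b) hab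
  have h := MATGraph.isMATLabeling_iff.2 hK
  refine ⟨lam', h, h, hlam, le_top, ?_⟩
  rintro ⟨e, he⟩
  induction e with
  | h a b =>
    have := hKL a b (MATGraph.toArray_pos.2 he)
    rw [MATGraph.toArray_of_mem he,
      MATGraph.toArray_of_mem (SimpleGraph.edgeSet_mono le_top he)] at this
    exact PNat.coe_injective this.symm
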